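/- Let $X$ be a measurable space in which singletons are measurable (for example $\mathbb{R}^n$, or a compact subset of it, with its Borel $\sigma$-algebra), and let $Y=\mathbb{R}$. Let $Y^X$ be the set of all measurable functions $X\to\mathbb{R}$ with the $\sigma$-algebra generated by the point evaluations $ev_x(f)=f(x)$. For functions $m:X\to\mathbb{R}$ and $k:X\times X\to\mathbb{R}$, a probability measure $P$ on $Y^X$ is a Gaussian process, $P\sim\mathcal{GP}(m,k)$, if for every finite $X_0\subset X$ the push-forward of $P$ to $\mathbb{R}^{X_0}$ is the (possibly degenerate) normal distribution $N(m|_{X_0},k|_{X_0})$ with positive semidefinite covariance matrix $k|_{X_0}$. A probability measure $\mu$ on a measurable space $H$ is perfect if for every measurable $f:H\to\mathbb{R}$ there is a Borel set $E\subseteq f(H)$ with $\mu(f^{-1}(E))=1$. Given a probability measure $P$ on $H$ and a Markov kernel $\mathcal{S}:H\to D$, an inference map is a Markov kernel $\mathcal{I}:D\to H$, all of whose values $\mathcal{I}(\cdot\mid y)$ are perfect, satisfying the product rule $$\int_B \mathcal{I}(A\mid y)\,d(\mathcal{S}\circ P)(y)=\int_A \mathcal{S}(B\mid h)\,dP(h)\qquad\text{for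 all measurable } A\subseteq H,\ B\subseteq D .$$ Let $P\sim\mathcal{GP}(m,k)$. **(1) One measurement.** Let $x\in X$ with $k(x,x)\neq 0$, and let $\mathcal{S}_x=\delta_{ev_x}:Y^X\to\mathbb{R}$ be the deterministic kernel $\mathcal{S}_x(B\mid f)=1_B(f(x))$. For $y\in\mathbb{R}$ put $$m^1_y(z)=m(z)+\frac{k(z,x)}{k(x,x)}\,(y-m(x)),\qquad k^1(w,z)=k(w,z)-\frac{k(w,x)\,k(x,z)}{k(x,x)} .$$ Then there is exactly one kernel $\mathcal{I}:\mathbb{R}\to Y^X$ with $\mathcal{I}(\cdot\mid y)\sim\mathcal{GP}(m^1_y,k^1)$ for all $y\in\mathbb{R}$, and it is an inference map for the prior $P$ and the sampling distribution $\mathcal{S}_x$. If $m$ and $k(\cdot,x)$ are measurable, then so is every $m^1_y$. **(2) Iteration.** Let $x_0,\dots,x_{N-1}\in X$ be such that the matrix $K(X_0,X_0)=(k(x_i,x_j))_{0\le i,j<N}$ is invertible, and let $y_0,\dots,y_{N-1}\in\mathbb{R}$. Put $m^0=m$, $k^0=k$ and, for $0\le i<N$, $$m^{i+1}(z)=m^i(z)+\frac{k^i(z,x_i)}{k^i(x_i,x_i)}\,(y_i-m^i(x_i)),\qquad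 k^{i+1}(w,z)=k^i(w,z)-\frac{k^i(w,x_i)\,k^i(x_i,z)}{k^i(x_i,x_i)} .$$ Then $k^i(x_i,x_i)>0$ for all $i<N$, and for all $w,z\in X$ $$m^N(z)=m(z)+K(z,X_0)K(X_0,X_0)^{-1}(\mathbf{y}-m(X_0)),\qquad k^N(w,z)=k(w,z)-K(w,X_0)K(X_0,X_0)^{-1}K(X_0,z),$$ where $K(z,X_0)=(k(z,x_i))_i$ is a row vector, and $K(X_0,z)=(k(x_i,z))_i$, $\mathbf{y}=(y_i)_i$, $m(X_0)=(m(x_i))_i$ are column vectors. Moreover there are measures $Q_0,\dots,Q_N$ on $Y^X$ and kernels $\mathcal{I}_0,\dots,\mathcal{I}_{N-1}:\mathbb{R}\to Y^X$ such that $Q_0=P$ and, for each $i<N$: for every $v\in\mathbb{R}$, $\mathcal{I}_i(\cdot\mid v)$ is the Gaussian process whose mean and covariance functions arise from $m^i,k^i$ by the update formulas of (1) for the measurement $(x_i,v)$; $\mathcal{I}_i$ is an inference map for the prior $Q_i$ and the sampling distribution $\delta_{ev_{x_i}}$; and $Q_{i+1}=\mathcal{I}_i(\cdot\mid y_i)$.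 They satisfy $Q_i\sim\mathcal{GP}(m^i,k^i)$ for $i\le N$; in particular $Q_N$ is the Gaussian process with the batch mean and covariance functions displayed above. If $m$ and all $k(\cdot,x_j)$, $j<N$, are measurable, then so is every $m^i$, $i\le N$. -/

import Mathlib

open MeasureTheory ProbabilityTheory

/-- The function space `Y^X` with `Y = ℝ`: all measurable functions `X → ℝ`.  Its measurable-space
structure is the subspace structure inherited from the product `X → ℝ`, which is the σ-algebra
generated by the point evaluations `f ↦ f x`. -/
abbrev FunctionSpace (X : Type*) [MeasurableSpace X] : Type _ :=
  {f : X → ℝ // Measurable f}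

namespace FunctionSpace

variable {X : Type*} [MeasurableSpace X]

/-- The point evaluation `ev_x : Y^X → Y`. -/
def ev (x : X) (f : FunctionSpace X) : ℝ := f.1 x

theorem measurable_ev (x : X) : Measurable (ev x) :=
  (measurable_pi_apply x).comp measurable_subtype_coe

/-- The restriction `Y^X → Y^{X₀}` to a finite set of points, with values in `ℝ^{X₀}`. -/
noncomputable def restrict (X₀ : Finset X) (f : FunctionSpace X) : EuclideanSpace ℝ X₀ :=
  WithLp.toLp 2 fun z => f.1 z

theorem measurable_restrict (X₀ : Finset X) : Measurable (restrict X₀) := by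
  refine (WithLp.measurable_toLp 2 _).comp (measurable_pi_lambda _ fun z => ?_)
  exact measurable_ev z.1

/-- The noise-free sampling distribution `δ_{ev_x} : Y^X → Y`, that is
`S(B ∣ f) = 1` if `f x ∈ B` and `0` otherwise. -/
noncomputable def sampling (x : X) : Kernel (FunctionSpace X) ℝ :=
  Kernel.deterministic (ev x) (measurable_ev x)

end FunctionSpace

open Classical in
/-- `μ ∼ N(a, S)`: the (possibly degenerate) multivariate normal distribution with mean `a` and
positive semidefinite covariance matrix `S`. -/
def IsNormal {ι : Type*} [Fintype ι] (a : ι → ℝ) (S : Matrix ι ι ℝ)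
    (μ : Measure (EuclideanSpace ℝ ι)) : Prop :=
  S.PosSemidef ∧ μ = multivariateGaussian (WithLp.toLp 2 a) S

/-- `P ∼ GP(m, k)`: `P` is a probability measure on `Y^X` all of whose push-forwards to finite
subsets `X₀` of `X` are normal with mean `m|_{X₀}` and covariance `k|_{X₀}`. -/
structure IsGP {X : Type*} [MeasurableSpace X] (m : X → ℝ) (k : X → X → ℝ)
    (P : Measure (FunctionSpace X)) : Prop where
  isProbabilityMeasure : IsProbabilityMeasure P
  isNormal : ∀ X₀ : Finset X,
    IsNormal (fun z : X₀ => m z) (Matrix.of fun w z : X₀ => k w z)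
      (P.map (FunctionSpace.restrict X₀))

/-- A probability measure `μ` on `H` is perfect if for every measurable `f : H → ℝ` there is a
Borel set `E ⊆ f(H)` with `μ (f⁻¹ E) = 1`. -/
def IsPerfect {H : Type*} [MeasurableSpace H] (μ : Measure H) : Prop :=
  ∀ f : H → ℝ, Measurable f →
    ∃ E : Set ℝ, MeasurableSet E ∧ E ⊆ Set.range f ∧ μ (f ⁻¹' E) = 1

/-- `I : D → H` is an inference map for the Bayesian model with prior `P` on `H` and sampling
distribution `S : H → D`: it is a Markov kernel with perfect values that satisfies the product
rule `∫_B I(A ∣ y) d(S ∘ P)(y) = ∫_A S(B ∣ h) dP(h)` for all measurable `A ⊆ H`, `B ⊆ D`. -/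
structure IsInferenceMap {H D : Type*} [MeasurableSpace H] [MeasurableSpace D]
    (P : Measure H) (S : Kernel H D) (I : Kernel D H) : Prop where
  isMarkovKernel : IsMarkovKernel I
  isPerfect : ∀ y : D, IsPerfect (I y)
  product_rule : ∀ (A : Set H) (B : Set D), MeasurableSet A → MeasurableSet B →
    ∫⁻ y in B, I y A ∂(P.bind S) = ∫⁻ h in A, S h B ∂P

section Updates

variable {X : Type*}

/-- The updated mean `m¹(z) = m(z) + k(z,x)/k(x,x) · (y - m(x))`. -/
noncomputable def meanUpdate (m : X → ℝ) (k : X → X → ℝ) (x : X) (y : ℝ) (z : X) : ℝ :=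
  m z + k z x / k x x * (y - m x)

/-- The updated covariance `k¹(w,z) = k(w,z) - k(w,x) k(x,z)/k(x,x)`. -/
noncomputable def covUpdate (k : X → X → ℝ) (x : X) (w z : X) : ℝ :=
  k w z - k w x * k x z / k x x

/-- The covariance `kⁱ` after the measurements at `x₀, …, xᵢ₋₁`. -/
noncomputable def iterCov (k : X → X → ℝ) (x : ℕ → X) : ℕ → X → X → ℝ
  | 0 => k
  | i + 1 => covUpdate (iterCov k x i) (x i)

/-- The mean `mⁱ` after the measurements `(x₀,y₀), …, (xᵢ₋₁,yᵢ₋₁)`. -/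
noncomputable def iterMean (m : X → ℝ) (k : X → X → ℝ) (x : ℕ → X) (y : ℕ → ℝ) : ℕ → X → ℝ
  | 0 => m
  | i + 1 => meanUpdate (iterMean m k x y i) (iterCov k x i) (x i) (y i)

/-- The matrix `K(X₀,X₀)` for `X₀ = (x₀, …, x_{N-1})`. -/
def gram (k : X → X → ℝ) (x : ℕ → X) (N : ℕ) : Matrix (Fin N) (Fin N) ℝ :=
  Matrix.of fun i j => k (x i) (x j)

open Matrix in
/-- The batch mean `m(z) + K(z,X₀) K(X₀,X₀)⁻¹ (y - m(X₀))`. -/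
noncomputable def batchMean (m : X → ℝ) (k : X → X → ℝ) (x : ℕ → X) (y : ℕ → ℝ) (N : ℕ)
    (z : X) : ℝ :=
  m z + (fun i : Fin N => k z (x i)) ⬝ᵥ ((gram k x N)⁻¹ *ᵥ fun i : Fin N => y i - m (x i))

open Matrix in
/-- The batch covariance `k(w,z) - K(w,X₀) K(X₀,X₀)⁻¹ K(X₀,z)`. -/
noncomputable def batchCov (k : X → X → ℝ) (x : ℕ → X) (N : ℕ) (w z : X) : ℝ :=
  k w z - (fun i : Fin N => k w (x i)) ⬝ᵥ ((gram k x N)⁻¹ *ᵥ fun i : Fin N => k (x i) z)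

end Updates

/-!
The posterior for one measurement is obtained by an explicit coupling. If `f` is a Gaussian process
and `c = k(·,x)/k(x,x)`, then the residual process `f - c · f(x)` and the value `f(x)` are jointly
Gaussian and uncorrelated, hence independent (`IsGP.indepFun_krigingResidual`). Therefore the law of
`f - c · f(x) + c · y` is a conditional law of `f` given `f(x) = y`, and its mean and covariance are
the updated ones.

The function `c` need not be measurable, so this law lives on the product space `X → ℝ` and has to
be brought back to the space of measurable functions. A measurable set of the product space depends
on countably many coordinates, and since singletons of `X` are measurable, every function on a
countable set extends to a measurable function on `X`. So the measurable functions have full outer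
measure for every measure on the product space (`measure_inter_range_val`), which therefore has a
trace on them (`traceMeasure`) with the same finite-dimensional marginals. The same extension
property shows that all probability measures on the function space are perfect
(`isPerfect_functionSpace`), by reduction to the Polish space `I → ℝ` with `I` countable.

Uniqueness follows because a Gaussian process is determined by its marginals (`IsGP.unique`).

For the iteration, `krige_succ` shows by block elimination that adding one point to the batch
formulas amounts to one update. The pivot `kⁱ(xᵢ,xᵢ)` is nonzero because the leading principal
minors of the positive definite Gram matrix are nonzero, and it is nonnegative because it is a
variance. The measures `Qᵢ` are then the Gaussian processes with the iterated mean and covariance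
functions.
-/

/-! ### Measures on the product space and on the space of measurable functions -/

section Trace

variable {X : Type*} [MeasurableSpace X]

theorem le_caratheodory_comap_val (μ : Measure (X → ℝ)) :
    (inferInstance : MeasurableSpace (FunctionSpace X)) ≤
      (OuterMeasure.comap ((↑) : FunctionSpace X → X → ℝ) μ.toOuterMeasure).caratheodory := by
  rintro _ ⟨A, hA, rfl⟩
  rw [OuterMeasure.isCaratheodory_iff]
  intro t
  simp only [OuterMeasure.comap_apply, Measure.coe_toOuterMeasure]
  have hdiff : ((↑) : FunctionSpace X → X → ℝ) '' (t \ (↑) ⁻¹' A) = ((↑) '' t) \ A := by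
    rw [Set.sdiff_eq, ← Set.preimage_compl, Set.image_inter_preimage, ← Set.sdiff_eq]
  rw [Set.image_inter_preimage, hdiff, measure_inter_add_sdiff _ hA]

/-- The trace on `FunctionSpace X` of a measure on the product space `X → ℝ`. It is induced by the
restricted outer measure, because `FunctionSpace X` is in general not a measurable subset of
`X → ℝ`. -/
noncomputable def traceMeasure (μ : Measure (X → ℝ)) : Measure (FunctionSpace X) :=
  (OuterMeasure.comap ((↑) : FunctionSpace X → X → ℝ) μ.toOuterMeasure).toMeasure
    (le_caratheodory_comap_val μ)

theorem ext_of_map_val {P Q : Measure (FunctionSpace X)}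
    (h : P.map ((↑) : FunctionSpace X → X → ℝ) = Q.map (↑)) : P = Q := by
  ext _ ⟨A, hA, rfl⟩
  rw [← Measure.map_apply measurable_subtype_coe hA, h,
    Measure.map_apply measurable_subtype_coe hA]

variable [MeasurableSingletonClass X]

theorem measurable_indicator_of_countable {I : Set X} (hI : I.Countable) (g : X → ℝ) :
    Measurable (I.indicator g) :=
  (measurable_const (a := (0 : ℝ))).measurable_of_countable_ne <|
    hI.mono fun z hz => by
      by_contra h
      exact hz (by simp [Set.indicator_of_notMem h])

/-- A nonempty measurable set of the product σ-algebra contains a measurable function: the set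
depends on countably many coordinates only, and a function with countable support is measurable. -/
theorem exists_measurable_mem {B : Set (X → ℝ)} (hB : MeasurableSet B) (hne : B.Nonempty) :
    ∃ f : FunctionSpace X, f.1 ∈ B := by
  obtain ⟨I, t, hI, rfl⟩ := hB.eq_preimage_restrict_countable
  obtain ⟨g, hg⟩ := hne
  refine ⟨⟨I.indicator g, measurable_indicator_of_countable hI g⟩, ?_⟩
  have : I.domRestrict (I.indicator g) = I.domRestrict g := by
    ext z; simp [Set.domRestrict]
  simpa [this] using hg

/-- The measurable functions are thick in `X → ℝ`: they have full outer measure in every measurable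
set, for every measure. -/
theorem measure_inter_range_val (μ : Measure (X → ℝ)) {A : Set (X → ℝ)} (hA : MeasurableSet A) :
    μ (A ∩ Set.range ((↑) : FunctionSpace X → X → ℝ)) = μ A := by
  refine le_antisymm (measure_mono Set.inter_subset_left) ?_
  rw [← measure_toMeasurable (A ∩ _)]
  refine measure_mono fun g hg => ?_
  -- Otherwise `A` minus a measurable hull of its measurable functions is nonempty and measurable,
  -- so it contains a measurable function, which lies in the hull.
  by_contra h
  obtain ⟨f, hfA, hf⟩ := exists_measurable_mem (hA.diff (measurableSet_toMeasurable μ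
    (A ∩ Set.range ((↑) : FunctionSpace X → X → ℝ)))) ⟨g, hg, h⟩
  exact hf (subset_toMeasurable _ _ ⟨hfA, f, rfl⟩)

/-- Passing to the trace loses no mass, so every measure on the product space comes from a measure
on the space of measurable functions. -/
theorem map_val_traceMeasure (μ : Measure (X → ℝ)) :
    (traceMeasure μ).map ((↑) : FunctionSpace X → X → ℝ) = μ := by
  ext A hA
  rw [Measure.map_apply measurable_subtype_coe hA, traceMeasure,
    toMeasure_apply _ _ (measurable_subtype_coe hA)]
  simp only [OuterMeasure.comap_apply, Measure.coe_toOuterMeasure]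
  rw [Set.image_preimage_eq_inter_range, measure_inter_range_val μ hA]

/-- The trace on `FunctionSpace X` of a kernel with values in the product space `X → ℝ`. -/
noncomputable def traceKernel {D : Type*} [MeasurableSpace D] (κ : Kernel D (X → ℝ)) :
    Kernel D (FunctionSpace X) where
  toFun y := traceMeasure (κ y)
  measurable' := by
    refine Measure.measurable_of_measurable_coe _ ?_
    rintro _ ⟨A, hA, rfl⟩
    simp_rw [← Measure.map_apply measurable_subtype_coe hA, map_val_traceMeasure]
    exact κ.measurable_coe hA

end Trace

/-! ### Perfect measures -/

section Perfect

/-- A finer Polish topology with the same Borel sets makes the given function continuous; then `E`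
is a countable union of images of compact sets whose measures tend to `1`. -/
theorem isPerfect_of_polishSpace {α : Type*} [t : TopologicalSpace α] [hα : PolishSpace α]
    [MeasurableSpace α] [BorelSpace α] (μ : Measure α) [IsProbabilityMeasure μ] : IsPerfect μ := by
  intro g hg
  obtain ⟨t', ht', hcont, hpol⟩ := hg.exists_continuous
  have hborel : @BorelSpace α t' _ := by
    refine @BorelSpace.mk _ t' _ ?_
    rw [borel_eq_borel_of_le hpol hα ht', ← BorelSpace.measurable_eq]
  clear ht'
  have key : ∀ n : ℕ, ∃ K : Set α, @IsCompact α t' K ∧ 1 - ((n : ENNReal) + 1)⁻¹ < μ K := by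
    intro n
    let := t'
    have h1 : 1 - ((n : ENNReal) + 1)⁻¹ < μ Set.univ := by
      rw [measure_univ]
      exact ENNReal.sub_lt_self (by simp) (by simp) (by simp)
    obtain ⟨K, -, hK, hlt⟩ := MeasurableSet.univ.exists_lt_isCompact h1
    exact ⟨K, hK, hlt⟩
  choose K hK hlt using key
  refine ⟨⋃ n, g '' K n, .iUnion fun n => ?_, Set.iUnion_subset fun n => Set.image_subset_range _ _,
    le_antisymm prob_le_one ?_⟩
  · exact (@IsCompact.image α ℝ t' _ _ _ (hK n) hcont).measurableSet
  · refine le_of_tendsto' (f := fun n : ℕ => 1 - ((n : ENNReal) + 1)⁻¹) (x := Filter.atTop) ?_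
      fun n => (hlt n).le.trans (measure_mono ?_)
    · simpa using ENNReal.Tendsto.sub tendsto_const_nhds
        (ENNReal.tendsto_inv_nat_nhds_zero.comp (Filter.tendsto_add_atTop_nat 1))
        (Or.inl ENNReal.one_ne_top)
    · exact fun a ha => Set.mem_iUnion.2 ⟨n, a, ha, rfl⟩

variable {X : Type*} [MeasurableSpace X]

/-- A real measurable function on `FunctionSpace X` depends on countably many evaluations: those
that determine its sublevel sets at rational levels. -/
theorem exists_countable_dependsOn {f : FunctionSpace X → ℝ} (hf : Measurable f) :
    ∃ I : Set X, I.Countable ∧ ∀ g h : FunctionSpace X, (∀ z ∈ I, g.1 z = h.1 z) → f g = f h := by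
  have key : ∀ q : ℚ, ∃ I : Set X, I.Countable ∧
      ∀ g h : FunctionSpace X, (∀ z ∈ I, g.1 z = h.1 z) → f g < q → f h < q := by
    intro q
    obtain ⟨A, hA, hAq⟩ := hf (measurableSet_Iio (a := (q : ℝ)))
    obtain ⟨I, t, hI, rfl⟩ := hA.eq_preimage_restrict_countable
    refine ⟨I, hI, fun g h hgh hg => ?_⟩
    have hmem : ∀ g : FunctionSpace X, f g < q ↔ I.domRestrict g.1 ∈ t := fun g => by
      rw [← Set.mem_Iio, ← Set.mem_preimage, ← hAq]; rfl
    rw [hmem] at hg ⊢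
    rwa [show I.domRestrict h.1 = I.domRestrict g.1 from funext fun z => (hgh z z.2).symm]
  choose I hI hfI using key
  have hle : ∀ g h : FunctionSpace X, (∀ z ∈ ⋃ q, I q, g.1 z = h.1 z) → f h ≤ f g := by
    intro g h hgh
    refine le_of_forall_lt_rat_imp_le fun q hq => ?_
    exact (hfI q g h (fun z hz => hgh z (Set.mem_iUnion_of_mem q hz)) hq).le
  exact ⟨⋃ q, I q, Set.countable_iUnion hI, fun g h hgh =>
    le_antisymm (hle h g fun z hz => (hgh z hz).symm) (hle g h hgh)⟩

variable [MeasurableSingletonClass X]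

/-- The extension by zero of a function on a countable set of points; it is measurable because its
support is countable. -/
noncomputable def extendZero {I : Set X} (hI : I.Countable) (u : I → ℝ) : FunctionSpace X :=
  ⟨Function.extend ((↑) : I → X) u 0, by
    have : Function.extend ((↑) : I → X) u 0 = I.indicator (Function.extend ((↑) : I → X) u 0) := by
      refine (Set.indicator_eq_self.2 fun z hz => ?_).symm
      by_contra h
      exact hz (Function.extend_apply' _ _ _ (by simpa using h))
    rw [this]
    exact measurable_indicator_of_countable hI _⟩

theorem extendZero_apply {I : Set X} (hI : I.Countable) (u : I → ℝ) (z : I) :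
    (extendZero hI u).1 z = u z :=
  Subtype.val_injective.extend_apply _ _ _

theorem measurable_extendZero {I : Set X} (hI : I.Countable) :
    Measurable (extendZero hI) := by
  refine (measurable_pi_lambda _ fun z => ?_).subtype_mk
  by_cases hz : z ∈ I
  · simpa only [Subtype.val_injective.extend_apply _ _ (⟨z, hz⟩ : I)]
      using measurable_pi_apply (⟨z, hz⟩ : I)
  · have hz' : ¬ ∃ a : I, (a : X) = z := by simpa using hz
    simpa only [Function.extend_apply' _ _ _ hz'] using measurable_const

/-- Every probability measure on `FunctionSpace X` is perfect. A measurable `f` factors through the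
restriction to a countable set `I`; since every function on `I` extends to a measurable function
on `X`, the factor on the Polish space `I → ℝ` has the same range as `f`. -/
theorem isPerfect_functionSpace (μ : Measure (FunctionSpace X)) [IsProbabilityMeasure μ] :
    IsPerfect μ := by
  intro f hf
  obtain ⟨I, hI, hfI⟩ := exists_countable_dependsOn hf
  have : Countable I := hI.to_subtype
  let r : FunctionSpace X → I → ℝ := fun h z => h.1 z
  have hr : Measurable r := measurable_pi_lambda _ fun z => FunctionSpace.measurable_ev z.1
  have hfr : ∀ h, f (extendZero hI (r h)) = f h := fun h =>
    hfI _ _ fun z hz => extendZero_apply hI (r h) ⟨z, hz⟩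
  have : IsProbabilityMeasure (μ.map r) := Measure.isProbabilityMeasure_map hr.aemeasurable
  obtain ⟨E, hE, hEr, hμ⟩ := isPerfect_of_polishSpace (μ.map r) (fun u => f (extendZero hI u))
    (hf.comp (measurable_extendZero hI))
  refine ⟨E, hE, hEr.trans ?_, ?_⟩
  · rintro _ ⟨u, rfl⟩
    exact ⟨_, rfl⟩
  · have hE' := (hf.comp (measurable_extendZero hI)) hE
    rw [Function.comp_def] at hE'
    rw [← hμ, Measure.map_apply hr hE']
    congr 1
    ext h
    simp [hfr]

end Perfect

open scoped Matrix

/-! ### Batch formulas solve the recursion -/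

section Iteration

variable {X : Type*} (k : X → X → ℝ) (x : ℕ → X)

/-- The kriging term `K(z,X₀) K(X₀,X₀)⁻¹ b`. With `b = y - m(X₀)` it is the correction in the batch
mean, with `b = K(X₀,z')` the one in the batch covariance. -/
noncomputable def krige (b : ℕ → ℝ) (N : ℕ) (z : X) : ℝ :=
  (fun i : Fin N => k z (x i)) ⬝ᵥ ((gram k x N)⁻¹ *ᵥ fun i : Fin N => b i)

/-- The kriging term can be computed from any solution `a` of the linear system `K(X₀,X₀) a = b`. -/
theorem krige_eq (b : ℕ → ℝ) {N : ℕ} (hdet : (gram k x N).det ≠ 0) {a : Fin N → ℝ}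
    (ha : gram k x N *ᵥ a = fun i : Fin N => b i) (z : X) :
    krige k x b N z = (fun i : Fin N => k z (x i)) ⬝ᵥ a := by
  rw [krige, ← ha, Matrix.mulVec_mulVec,
    Matrix.nonsing_inv_mul _ (isUnit_iff_ne_zero.2 hdet), Matrix.one_mulVec]

theorem krige_weights (b : ℕ → ℝ) {N : ℕ} (hdet : (gram k x N).det ≠ 0) :
    ∃ a : Fin N → ℝ, gram k x N *ᵥ a = fun i : Fin N => b i :=
  ⟨(gram k x N)⁻¹ *ᵥ fun i : Fin N => b i, by
    rw [Matrix.mulVec_mulVec, Matrix.mul_nonsing_inv _ (isUnit_iff_ne_zero.2 hdet),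
      Matrix.one_mulVec]⟩

theorem batchCov_eq (N : ℕ) (w z : X) :
    batchCov k x N w z = k w z - krige k x (fun i => k (x i) z) N w := rfl

theorem batchMean_eq (m : X → ℝ) (y : ℕ → ℝ) (N : ℕ) (z : X) :
    batchMean m k x y N z = m z + krige k x (fun i => y i - m (x i)) N z := rfl

theorem dotProduct_snoc (N : ℕ) (z : X) (a : Fin N → ℝ) (t : ℝ) :
    (fun i : Fin (N + 1) => k z (x i)) ⬝ᵥ (Fin.snoc a t : Fin (N + 1) → ℝ) =
      (fun i : Fin N => k z (x i)) ⬝ᵥ a + k z (x N) * t := by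
  simp [dotProduct, Fin.sum_univ_castSucc]

theorem gram_mulVec_snoc (N : ℕ) (a : Fin N → ℝ) (t : ℝ) (j : Fin (N + 1)) :
    (gram k x (N + 1) *ᵥ (Fin.snoc a t : Fin (N + 1) → ℝ)) j =
      (fun i : Fin N => k (x j) (x i)) ⬝ᵥ a + k (x j) (x N) * t :=
  dotProduct_snoc k x N (x j) a t

/-- The batch covariance at the next point is the Schur complement of the Gram matrix; it does not
vanish if the larger Gram matrix is invertible. -/
theorem batchCov_self_ne_zero {N : ℕ} (h : (gram k x N).det ≠ 0)
    (h' : (gram k x (N + 1)).det ≠ 0) : batchCov k x N (x N) (x N) ≠ 0 := by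
  intro hs
  obtain ⟨α, hα⟩ := krige_weights k x (fun i => k (x i) (x N)) h
  rw [batchCov_eq, krige_eq k x (fun i => k (x i) (x N)) h hα] at hs
  -- If it vanished, `(-α, 1)` would be in the kernel of the larger Gram matrix.
  have hker : gram k x (N + 1) *ᵥ (Fin.snoc (-α) 1 : Fin (N + 1) → ℝ) = 0 := by
    ext j
    rw [gram_mulVec_snoc]
    refine Fin.lastCases ?_ (fun j => ?_) j
    · simp only [Fin.val_last, dotProduct_neg, Pi.zero_apply]
      linarith
    · have := congrFun hα j
      simp only [gram, Matrix.mulVec, Matrix.of_apply] at this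
      simp only [Fin.val_castSucc, dotProduct_neg, Pi.zero_apply]
      linarith
  have := congrFun (Matrix.eq_zero_of_mulVec_eq_zero h' hker) (Fin.last N)
  simp at this

/-- Adding one point changes the kriging term by a single update with the current batch covariance.
Applied to the right-hand sides of mean and covariance, this is the whole recursion. -/
theorem krige_succ (b : ℕ → ℝ) {N : ℕ} (h : (gram k x N).det ≠ 0)
    (h' : (gram k x (N + 1)).det ≠ 0) (z : X) :
    krige k x b (N + 1) z = krige k x b N z +
      batchCov k x N z (x N) / batchCov k x N (x N) (x N) * (b N - krige k x b N (x N)) := by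
  have hs := batchCov_self_ne_zero k x h h'
  obtain ⟨α, hα⟩ := krige_weights k x (fun i => k (x i) (x N)) h
  obtain ⟨a, ha⟩ := krige_weights k x b h
  simp only [batchCov_eq, krige_eq k x (fun i => k (x i) (x N)) h hα, krige_eq k x b h ha] at hs ⊢
  set s := k (x N) (x N) - (fun i : Fin N => k (x N) (x i)) ⬝ᵥ α with hsdef
  set t := (b N - (fun i : Fin N => k (x N) (x i)) ⬝ᵥ a) / s with ht
  have hts : t * s = b N - (fun i : Fin N => k (x N) (x i)) ⬝ᵥ a := div_mul_cancel₀ _ hs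
  -- Block elimination: the weights for `N + 1` points are `(a - t α, t)`.
  have hsol : gram k x (N + 1) *ᵥ (Fin.snoc (a - t • α) t : Fin (N + 1) → ℝ) =
      fun i : Fin (N + 1) => b i := by
    ext j
    rw [gram_mulVec_snoc]
    refine Fin.lastCases ?_ (fun j => ?_) j
    · simp only [Fin.val_last, dotProduct_sub, dotProduct_smul, smul_eq_mul]
      rw [hsdef] at hts
      linarith
    · have h1 := congrFun hα j
      have h2 := congrFun ha j
      simp only [gram, Matrix.mulVec, Matrix.of_apply] at h1 h2
      simp only [Fin.val_castSucc, dotProduct_sub, dotProduct_smul, smul_eq_mul, h1, h2]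
      ring
  rw [krige_eq k x b h' hsol, dotProduct_snoc, dotProduct_sub, dotProduct_smul, smul_eq_mul, ← hts]
  field_simp
  ring

variable {k x}

theorem batchCov_succ {N : ℕ} (h : (gram k x N).det ≠ 0) (h' : (gram k x (N + 1)).det ≠ 0) :
    batchCov k x (N + 1) = covUpdate (batchCov k x N) (x N) := by
  ext w z
  rw [covUpdate, batchCov_eq, krige_succ k x _ h h', batchCov_eq k x N w z,
    batchCov_eq k x N (x N) z]
  ring

theorem batchMean_succ (m : X → ℝ) (y : ℕ → ℝ) {N : ℕ} (h : (gram k x N).det ≠ 0)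
    (h' : (gram k x (N + 1)).det ≠ 0) :
    batchMean m k x y (N + 1) =
      meanUpdate (batchMean m k x y N) (batchCov k x N) (x N) (y N) := by
  ext z
  rw [meanUpdate, batchMean_eq, krige_succ k x _ h h', batchMean_eq, batchMean_eq]
  ring

theorem iterCov_eq_batchCov {N : ℕ} (h : ∀ i ≤ N, (gram k x i).det ≠ 0) :
    iterCov k x N = batchCov k x N := by
  induction N with
  | zero => ext w z; simp [iterCov, batchCov]
  | succ N ih =>
    rw [iterCov, ih fun i hi => h i (by omega), batchCov_succ (h N (by omega)) (h _ le_rfl)]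

theorem iterMean_eq_batchMean (m : X → ℝ) (y : ℕ → ℝ) {N : ℕ}
    (h : ∀ i ≤ N, (gram k x i).det ≠ 0) :
    iterMean m k x y N = batchMean m k x y N := by
  induction N with
  | zero => ext z; simp [iterMean, batchMean]
  | succ N ih =>
    rw [iterMean, ih fun i hi => h i (by omega), iterCov_eq_batchCov fun i hi => h i (by omega),
      batchMean_succ m y (h N (by omega)) (h _ le_rfl)]

theorem det_gram_ne_zero_of_le {N : ℕ} (hpsd : (gram k x N).PosSemidef)
    (h : (gram k x N).det ≠ 0) {i : ℕ} (hi : i ≤ N) : (gram k x i).det ≠ 0 := by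
  have hpd := hpsd.posDef_iff_det_ne_zero.2 h
  have : gram k x i = (gram k x N).submatrix (Fin.castLE hi) (Fin.castLE hi) := rfl
  rw [this]
  exact (hpd.submatrix (Fin.castLE_injective hi)).det_pos.ne'

theorem measurable_iterCov [MeasurableSpace X] {N : ℕ}
    (h : ∀ j < N, Measurable fun z => k z (x j)) {i : ℕ} (hi : i ≤ N) :
    ∀ j < N, Measurable fun z => iterCov k x i z (x j) := by
  induction i with
  | zero => exact h
  | succ i ih =>
    have ih := ih (by omega)
    exact fun j hj => (ih j hj).sub (((ih i hi).mul_const _).div_const _)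

theorem measurable_meanUpdate [MeasurableSpace X] {m : X → ℝ} {x : X} (hm : Measurable m)
    (hk : Measurable fun z => k z x) (y : ℝ) : Measurable (meanUpdate m k x y) :=
  hm.add ((hk.div_const _).mul_const _)

theorem measurable_iterMean [MeasurableSpace X] {m : X → ℝ} (hm : Measurable m) (y : ℕ → ℝ)
    {N : ℕ} (h : ∀ j < N, Measurable fun z => k z (x j)) {i : ℕ} (hi : i ≤ N) :
    Measurable (iterMean m k x y i) := by
  induction i with
  | zero => exact hm
  | succ i ih =>
    exact measurable_meanUpdate (ih (by omega)) (measurable_iterCov h (by omega) i hi) _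

end Iteration

/-! ### Gaussian processes as laws of evaluations -/

section GaussianProcess

/-- A Gaussian vector has the normal law with its mean and covariance matrix, which is in particular
positive semidefinite. -/
theorem isNormal_map_toLp {Ω ι : Type*} [MeasurableSpace Ω] [Fintype ι]
    {P : Measure Ω} {Z : ι → Ω → ℝ} (hZ : HasGaussianLaw (fun ω => WithLp.toLp 2 (Z · ω)) P)
    {a : ι → ℝ} {S : Matrix ι ι ℝ} (hm : ∀ i, ∫ ω, Z i ω ∂P = a i)
    (hS : ∀ i j, cov[Z i, Z j; P] = S i j) :
    IsNormal a S (P.map fun ω => WithLp.toLp 2 (Z · ω)) := by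
  classical
  have hg := hZ.isGaussian_map
  have := hZ.isProbabilityMeasure
  have hZm : AEMeasurable (fun ω => WithLp.toLp 2 (Z · ω)) P := hZ.aemeasurable
  have hLp : ∀ i, MemLp (Z i) 2 P := fun i =>
    (hZ.map (EuclideanSpace.proj (𝕜 := ℝ) i)).memLp_two
  have hcov : ∀ u v : EuclideanSpace ℝ ι,
      covarianceBilin (P.map fun ω => WithLp.toLp 2 (Z · ω)) u v = u ⬝ᵥ S *ᵥ v := by
    intro u v
    rw [covarianceBilin_apply_pi hLp]
    simp [dotProduct, Matrix.mulVec, Finset.mul_sum, hS, mul_comm, mul_left_comm]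
  have hpsd : S.PosSemidef := by
    refine .of_dotProduct_mulVec_nonneg ?_ fun u => ?_
    · ext i j
      simp [← hS, covariance_comm]
    · have := hcov (WithLp.toLp 2 u) (WithLp.toLp 2 u)
      simp only [star_trivial]
      rw [← this]
      exact covarianceBilin_self_nonneg _
  refine ⟨hpsd, IsGaussian.ext ?_ ?_⟩
  · rw [integral_id_multivariateGaussian', integral_map hZm (by fun_prop)]
    ext i
    refine Eq.trans ?_ (hm i)
    have := (EuclideanSpace.proj (𝕜 := ℝ) i).integral_comp_comm hZ.integrable
    simpa using this.symm
  · ext u v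
    rw [hcov]
    convert (covarianceBilin_multivariateGaussian hpsd u v).symm

variable {X : Type*} [MeasurableSpace X] {m : X → ℝ} {k : X → X → ℝ} {P : Measure (FunctionSpace X)}

theorem IsGP.isGaussianProcess (hP : IsGP m k P) : IsGaussianProcess FunctionSpace.ev P where
  hasGaussianLaw I := by
    have h := hP.isNormal I
    have hg : HasGaussianLaw (FunctionSpace.restrict I) P := by
      refine ⟨?_⟩
      rw [h.2]
      infer_instance
    exact hg.map (PiLp.continuousLinearEquiv 2 ℝ (fun _ : I => ℝ) : EuclideanSpace ℝ I →L[ℝ] I → ℝ)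

theorem IsGP.integral_ev (hP : IsGP m k P) (z : X) : ∫ f, FunctionSpace.ev z f ∂P = m z := by
  classical
  have h := hP.isNormal {z}
  let z' : ({z} : Finset X) := ⟨z, Finset.mem_singleton_self z⟩
  have h2 := congrArg (fun μ => ∫ u, u z' ∂μ) h.2
  simp only at h2
  rw [integral_map (FunctionSpace.measurable_restrict _).aemeasurable (by fun_prop)] at h2
  have hmean := (EuclideanSpace.proj (𝕜 := ℝ) z').integral_comp_comm
    (IsGaussian.integrable_id (μ := multivariateGaussian
      (WithLp.toLp 2 fun w : ({z} : Finset X) => m w)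
      (Matrix.of fun w v : ({z} : Finset X) => k w v)))
  simp only [PiLp.proj_apply, id_eq, integral_id_multivariateGaussian] at hmean
  refine h2.trans ?_
  convert hmean

theorem IsGP.covariance_ev (hP : IsGP m k P) (w z : X) :
    cov[FunctionSpace.ev w, FunctionSpace.ev z; P] = k w z := by
  classical
  have h := hP.isNormal {w, z}
  have h2 := congrArg (fun μ => cov[fun u => u ⟨w, by simp⟩, fun u => u ⟨z, by simp⟩; μ]) h.2
  simp only at h2
  rw [covariance_map (by fun_prop) (by fun_prop)
    (FunctionSpace.measurable_restrict _).aemeasurable] at h2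
  refine h2.trans ?_
  convert covariance_eval_multivariateGaussian h.1 _ _
  rfl

theorem IsGP.memLp (hP : IsGP m k P) (z : X) : MemLp (FunctionSpace.ev z) 2 P :=
  (hP.isGaussianProcess.hasGaussianLaw_eval z).memLp_two

/-- A Gaussian process measure is determined by its mean and covariance functions, since its image
in the product space is the projective limit of its finite-dimensional marginals. -/
theorem IsGP.unique {Q : Measure (FunctionSpace X)} (hP : IsGP m k P) (hQ : IsGP m k Q) :
    P = Q := by
  classical
  let F (I : Finset X) : Measure (I → ℝ) :=
    (multivariateGaussian (WithLp.toLp 2 fun z : I => m z) (Matrix.of fun w z : I => k w z)).map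
      (fun u => u.ofLp)
  have key : ∀ {R : Measure (FunctionSpace X)}, IsGP m k R →
      IsProjectiveLimit (R.map ((↑) : FunctionSpace X → X → ℝ)) F := by
    intro R hR I
    have h : R.map (FunctionSpace.restrict I) = multivariateGaussian
        (WithLp.toLp 2 fun z : I => m z) (Matrix.of fun w z : I => k w z) := by
      convert (hR.isNormal I).2
    simp only [F]
    rw [Measure.map_map (by fun_prop) measurable_subtype_coe, ← h,
      Measure.map_map (by fun_prop) (FunctionSpace.measurable_restrict I)]
    rfl
  have (I : Finset X) : IsFiniteMeasure (F I) := by simp only [F]; infer_instance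
  exact ext_of_map_val ((key hP).unique (key hQ))

/-- The law of a real Gaussian process is realized on `FunctionSpace X`, even if its sample paths
are not measurable functions. -/
theorem isGP_traceMeasure [MeasurableSingletonClass X] {Ω : Type*} [MeasurableSpace Ω]
    {μ : Measure Ω} {Z : X → Ω → ℝ} (hZm : ∀ z, Measurable (Z z)) [IsProbabilityMeasure μ]
    (hZ : IsGaussianProcess Z μ) (hm : ∀ z, ∫ ω, Z z ω ∂μ = m z)
    (hk : ∀ w z, cov[Z w, Z z; μ] = k w z) :
    IsGP m k (traceMeasure (μ.map fun ω z => Z z ω)) := by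
  have hmeas : Measurable fun ω z => Z z ω := measurable_pi_lambda _ hZm
  have hmap := map_val_traceMeasure (μ.map fun ω z => Z z ω)
  have : IsProbabilityMeasure (μ.map fun ω z => Z z ω) :=
    Measure.isProbabilityMeasure_map hmeas.aemeasurable
  refine ⟨?_, fun I => ?_⟩
  · rw [← hmap] at this
    exact Measure.isProbabilityMeasure_of_map ((↑) : FunctionSpace X → X → ℝ)
  · have hcoord : Measurable fun g : X → ℝ =>
        (WithLp.toLp 2 fun z : I => g z : EuclideanSpace ℝ I) := by fun_prop
    have hres : (traceMeasure (μ.map fun ω z => Z z ω)).map (FunctionSpace.restrict I) =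
        μ.map fun ω => WithLp.toLp 2 fun z : I => Z z ω := by
      calc _ = ((traceMeasure (μ.map fun ω z => Z z ω)).map (↑)).map
            (fun g : X → ℝ => (WithLp.toLp 2 fun z : I => g z : EuclideanSpace ℝ I)) := by
              rw [Measure.map_map hcoord measurable_subtype_coe]; rfl
        _ = _ := by rw [hmap, Measure.map_map hcoord hmeas]; rfl
    rw [hres]
    refine isNormal_map_toLp (Z := fun (z : I) ω => Z z ω) ?_ (fun i => hm i)
      fun i j => hk i j
    exact (hZ.hasGaussianLaw I).map ((PiLp.continuousLinearEquiv 2 ℝ (fun _ : I => ℝ)).symm :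
      (I → ℝ) →L[ℝ] EuclideanSpace ℝ I)

end GaussianProcess

/-! ### Conditioning on one measurement -/

section Conditioning

theorem IsGaussianProcess.add_const {T Ω : Type*} [MeasurableSpace Ω] {P : Measure Ω}
    {Z : T → Ω → ℝ} (hZ : IsGaussianProcess Z P) (c : T → ℝ) :
    IsGaussianProcess (fun t ω => Z t ω + c t) P where
  hasGaussianLaw I := by
    have h := (hZ.hasGaussianLaw I)
    have := h.isGaussian_map
    refine ⟨?_⟩
    have hmap : P.map (fun ω => I.restrict fun t => Z t ω + c t) =
        (P.map fun ω => I.restrict (Z · ω)).map (fun u => u + I.restrict c) := by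
      rw [AEMeasurable.map_map_of_aemeasurable (by fun_prop) h.aemeasurable]
      rfl
    rw [hmap]
    infer_instance

variable {X : Type*} [MeasurableSpace X] {m : X → ℝ} {k : X → X → ℝ} {P : Measure (FunctionSpace X)}

open FunctionSpace (ev measurable_ev)

/-- The residual `f(z) - k(z,x)/k(x,x) · f(x)` of the regression of `f(z)` on `f(x)`. -/
noncomputable def krigingResidual (k : X → X → ℝ) (x z : X) (f : FunctionSpace X) : ℝ :=
  ev z f - k z x / k x x * ev x f

@[fun_prop]
theorem measurable_krigingResidual (k : X → X → ℝ) (x z : X) : Measurable (krigingResidual k x z) :=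
  (measurable_ev z).sub ((measurable_ev x).const_mul _)

theorem IsGP.isGaussianProcess_sumElim (hP : IsGP m k P) (x : X) :
    IsGaussianProcess (Sum.elim (krigingResidual k x) fun _ : Unit => ev x) P := by
  classical
  refine hP.isGaussianProcess.of_isGaussianProcess fun s => ?_
  rcases s with z | _
  · exact ⟨{z, x}, ContinuousLinearMap.proj ⟨z, by simp⟩ -
      (k z x / k x x) • ContinuousLinearMap.proj ⟨x, by simp⟩, fun f => rfl⟩
  · exact ⟨{x}, ContinuousLinearMap.proj ⟨x, by simp⟩, fun f => rfl⟩

theorem IsGP.covariance_krigingResidual_ev (hP : IsGP m k P) {x : X} (hx : k x x ≠ 0) (z : X) :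
    cov[krigingResidual k x z, ev x; P] = 0 := by
  have := hP.isProbabilityMeasure
  unfold krigingResidual
  rw [covariance_fun_sub_left (hP.memLp z) ((hP.memLp x).const_mul _) (hP.memLp x),
    covariance_const_mul_left, hP.covariance_ev, hP.covariance_ev, div_mul_cancel₀ _ hx, sub_self]

/-- The residual process is independent of the measured value: the two are jointly Gaussian and
uncorrelated. -/
theorem IsGP.indepFun_krigingResidual (hP : IsGP m k P) {x : X} (hx : k x x ≠ 0) :
    IndepFun (ev x) (fun f z => krigingResidual k x z f) P := by
  have h := (hP.isGaussianProcess_sumElim x).indepFun_of_covariance_eq_zero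
    (fun z => (measurable_krigingResidual k x z).aemeasurable)
    (fun _ => (measurable_ev x).aemeasurable)
    fun z _ => hP.covariance_krigingResidual_ev hx z
  exact (h.comp (φ := id) (ψ := fun u : Unit → ℝ => u ()) measurable_id
    (measurable_pi_apply _)).symm

/-- The function `f` with its value at `x` replaced by `y` (if `k x x ≠ 0`) and all other values
corrected by regression. It need not be measurable, as `k(·,x)` need not be. -/
noncomputable def recenter (k : X → X → ℝ) (x : X) (y : ℝ) (f : FunctionSpace X) (z : X) : ℝ :=
  krigingResidual k x z f + k z x / k x x * y

theorem measurable_recenter (k : X → X → ℝ) (x : X) :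
    Measurable fun p : ℝ × FunctionSpace X => recenter k x p.1 p.2 :=
  measurable_pi_lambda _ fun z =>
    ((measurable_krigingResidual k x z).comp measurable_snd).add (measurable_fst.const_mul _)

theorem recenter_self (k : X → X → ℝ) (x : X) (f : FunctionSpace X) :
    recenter k x (ev x f) f = f.1 := by
  ext z; simp [recenter, krigingResidual, ev]

variable [MeasurableSingletonClass X]

/-- The posterior after measuring at `x`: for the value `y` it is the trace on `FunctionSpace X` of
the law of `recenter k x y f`, where `f` has law `P`. -/
noncomputable def posteriorKernel (P : Measure (FunctionSpace X)) [SFinite P] (k : X → X → ℝ)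
    (x : X) : Kernel ℝ (FunctionSpace X) :=
  traceKernel ((Kernel.id ×ₖ Kernel.const ℝ P).map fun p => recenter k x p.1 p.2)

theorem posteriorKernel_apply (P : Measure (FunctionSpace X)) [SFinite P] (k : X → X → ℝ) (x : X)
    (y : ℝ) : posteriorKernel P k x y = traceMeasure (P.map fun f => recenter k x y f) := by
  change traceMeasure (((Kernel.id ×ₖ Kernel.const ℝ P).map fun p => recenter k x p.1 p.2) y) = _
  rw [Kernel.map_apply _ (measurable_recenter k x), Kernel.prod_apply, Kernel.id_apply,
    Kernel.const_apply, Measure.dirac_prod, Measure.map_map (measurable_recenter k x) (by fun_prop)]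
  rfl

theorem IsGP.isGP_posteriorKernel [IsProbabilityMeasure P] (hP : IsGP m k P) {x : X}
    (hx : k x x ≠ 0) (y : ℝ) :
    IsGP (meanUpdate m k x y) (covUpdate k x) (posteriorKernel P k x y) := by
  rw [posteriorKernel_apply]
  have hr : ∀ z, MemLp (krigingResidual k x z) 2 P := fun z =>
    (hP.memLp z).sub ((hP.memLp x).const_mul _)
  refine isGP_traceMeasure (Z := fun z f => recenter k x y f z)
    (fun z => (measurable_krigingResidual k x z).add_const _) ?_ (fun z => ?_) fun w z => ?_
  · exact IsGaussianProcess.add_const ((hP.isGaussianProcess_sumElim x).comp_right Sum.inl) _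
  · simp only [recenter, krigingResidual]
    have hz := (hP.memLp z).integrable one_le_two
    have hx := ((hP.memLp x).integrable one_le_two).const_mul (k z x / k x x)
    rw [integral_add (by exact hz.sub hx) (integrable_const _), integral_sub hz hx,
      integral_const_mul, hP.integral_ev, hP.integral_ev, integral_const, probReal_univ, one_smul,
      meanUpdate]
    ring
  · simp only [recenter]
    rw [covariance_add_const_left ((hr w).integrable one_le_two),
      covariance_add_const_right ((hr z).integrable one_le_two)]
    have h1 : cov[krigingResidual k x w, krigingResidual k x z; P] =
        cov[krigingResidual k x w, ev z; P] -
          k z x / k x x * cov[krigingResidual k x w, ev x; P] := by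
      rw [← covariance_const_mul_right, ← covariance_fun_sub_right (hr w) (hP.memLp z)
        ((hP.memLp x).const_mul _)]
      rfl
    rw [h1, hP.covariance_krigingResidual_ev hx]
    unfold krigingResidual
    rw [covariance_fun_sub_left (hP.memLp w) ((hP.memLp x).const_mul _) (hP.memLp z),
      covariance_const_mul_left, hP.covariance_ev, hP.covariance_ev, covUpdate]
    ring

/-- The product rule is the disintegration of `f = residual + k(·,x)/k(x,x) · f(x)` along the
independent pair of measured value and residual. -/
theorem IsGP.isInferenceMap_posteriorKernel [IsProbabilityMeasure P] (hP : IsGP m k P) {x : X}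
    (hx : k x x ≠ 0) : IsInferenceMap P (FunctionSpace.sampling x) (posteriorKernel P k x) := by
  have hI : ∀ y, IsProbabilityMeasure (posteriorKernel P k x y) := fun y =>
    (hP.isGP_posteriorKernel hx y).isProbabilityMeasure
  refine ⟨⟨hI⟩, fun y => isPerfect_functionSpace _, fun A B hA hB => ?_⟩
  obtain ⟨A, hA', rfl⟩ := hA
  have hres : Measurable fun (f : FunctionSpace X) z => krigingResidual k x z f :=
    measurable_pi_lambda _ (measurable_krigingResidual k x)
  have hshift : Measurable fun p : ℝ × (X → ℝ) => fun z => p.2 z + k z x / k x x * p.1 := by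
    fun_prop
  have hT : MeasurableSet
      {p : ℝ × (X → ℝ) | p.1 ∈ B ∧ (fun z => p.2 z + k z x / k x x * p.1) ∈ A} :=
    (measurable_fst hB).inter (hshift hA')
  have hval : ∀ y, posteriorKernel P k x y ((↑) ⁻¹' A) =
      (P.map fun f z => krigingResidual k x z f) {g | (fun z => g z + k z x / k x x * y) ∈ A} := by
    intro y
    rw [posteriorKernel_apply, ← Measure.map_apply measurable_subtype_coe hA', map_val_traceMeasure,
      Measure.map_apply (by exact (measurable_recenter k x).comp measurable_prodMk_left) hA',
      Measure.map_apply hres (by exact (hshift.comp (measurable_prodMk_left (x := y))) hA')]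
    rfl
  calc ∫⁻ y in B, posteriorKernel P k x y ((↑) ⁻¹' A) ∂(P.bind (FunctionSpace.sampling x))
      = ∫⁻ y in B, (P.map fun f z => krigingResidual k x z f)
          {g | (fun z => g z + k z x / k x x * y) ∈ A} ∂(P.map (ev x)) := by
        rw [FunctionSpace.sampling, Measure.deterministic_comp_eq_map]
        simp_rw [hval]
    _ = ((P.map (ev x)).prod (P.map fun f z => krigingResidual k x z f))
          {p | p.1 ∈ B ∧ (fun z => p.2 z + k z x / k x x * p.1) ∈ A} := by
        rw [Measure.prod_apply hT, ← lintegral_indicator hB]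
        refine lintegral_congr fun y => ?_
        by_cases hy : y ∈ B <;> simp [hy]
    _ = P ((↑) ⁻¹' A ∩ ev x ⁻¹' B) := by
        rw [← (hP.indepFun_krigingResidual hx).map_prod_eq_prod_map_map
          (measurable_ev x).aemeasurable hres.aemeasurable,
          Measure.map_apply ((measurable_ev x).prodMk hres) hT]
        congr 1
        ext f
        simp only [Set.mem_preimage, Set.mem_inter_iff, Set.mem_ofPred_eq]
        rw [and_comm]
        have := recenter_self k x f
        unfold recenter at this
        rw [this]
    _ = ∫⁻ h in (↑) ⁻¹' A, FunctionSpace.sampling x h B ∂P := by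
        have hEv : MeasurableSet (ev x ⁻¹' B) := measurable_ev x hB
        have hS : ∀ h : FunctionSpace X,
            FunctionSpace.sampling x h B = (ev x ⁻¹' B).indicator 1 h := fun h => by
          rw [FunctionSpace.sampling, Kernel.deterministic_apply' _ _ hB]
          rfl
        simp_rw [hS]
        rw [lintegral_indicator_one hEv, Measure.restrict_apply hEv, Set.inter_comm]

theorem IsGP.eq_posteriorKernel [IsProbabilityMeasure P] (hP : IsGP m k P) {x : X}
    (hx : k x x ≠ 0) {I : Kernel ℝ (FunctionSpace X)}
    (hI : ∀ y, IsGP (meanUpdate m k x y) (covUpdate k x) (I y)) : I = posteriorKernel P k x :=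
  Kernel.ext fun y => (hI y).unique (hP.isGP_posteriorKernel hx y)

end Conditioning

/-! ### Successive measurements -/

section Sequence

variable {X : Type*} [MeasurableSpace X] {m : X → ℝ} {k : X → X → ℝ} {P : Measure (FunctionSpace X)}

theorem IsGP.cov_self_nonneg (hP : IsGP m k P) (z : X) : 0 ≤ k z z := by
  rw [← hP.covariance_ev, covariance_self (FunctionSpace.measurable_ev z).aemeasurable]
  exact variance_nonneg _ _

theorem IsGP.posSemidef_gram (hP : IsGP m k P) (x : ℕ → X) (N : ℕ) : (gram k x N).PosSemidef := by
  classical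
  exact (hP.isNormal (Finset.univ.image fun i : Fin N => x i)).1.submatrix
    fun i : Fin N => ⟨x i, Finset.mem_image_of_mem _ (Finset.mem_univ i)⟩

variable [MeasurableSingletonClass X]

theorem IsGP.exists_isInferenceMap (hP : IsGP m k P) {x : X} (hx : k x x ≠ 0) :
    ∃ I : Kernel ℝ (FunctionSpace X),
      (∀ y, IsGP (meanUpdate m k x y) (covUpdate k x) (I y)) ∧
        IsInferenceMap P (FunctionSpace.sampling x) I := by
  have := hP.isProbabilityMeasure
  exact ⟨_, hP.isGP_posteriorKernel hx, hP.isInferenceMap_posteriorKernel hx⟩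

/-- Each `Q i` is chosen separately, as the Gaussian process with the iterated mean and covariance
functions; by uniqueness `Q (i + 1)` is then the posterior of `Q i` after the measurement at
`x i`. -/
theorem IsGP.exists_iterated_inference (hP : IsGP m k P) {N : ℕ} {x : ℕ → X} (y : ℕ → ℝ)
    (hx : ∀ i < N, iterCov k x i (x i) (x i) ≠ 0) :
    ∃ (Q : ℕ → Measure (FunctionSpace X)) (I : ℕ → Kernel ℝ (FunctionSpace X)),
      Q 0 = P ∧
      (∀ i < N,
        (∀ v : ℝ, IsGP (meanUpdate (iterMean m k x y i) (iterCov k x i) (x i) v)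
          (covUpdate (iterCov k x i) (x i)) (I i v)) ∧
        IsInferenceMap (Q i) (FunctionSpace.sampling (x i)) (I i) ∧
        Q (i + 1) = I i (y i)) ∧
      ∀ i ≤ N, IsGP (iterMean m k x y i) (iterCov k x i) (Q i) := by
  have hex : ∀ i ≤ N, ∃ R, IsGP (iterMean m k x y i) (iterCov k x i) R := by
    intro i
    induction i with
    | zero => exact fun _ => ⟨P, hP⟩
    | succ i ih =>
      intro hi
      obtain ⟨R, hR⟩ := ih (by omega)
      obtain ⟨I, hI, -⟩ := hR.exists_isInferenceMap (hx i hi)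
      exact ⟨I (y i), hI (y i)⟩
  choose! Q hQ using hex
  have hstep := fun i (hi : i < N) => (hQ i hi.le).exists_isInferenceMap (hx i hi)
  choose! I hI hinf using hstep
  exact ⟨Q, I, (hQ 0 (Nat.zero_le N)).unique hP,
    fun i hi => ⟨hI i hi, hinf i hi, (hQ (i + 1) hi).unique (hI i hi (y i))⟩, hQ⟩

end Sequence

/-! ### Gaussian process regression -/

theorem mainTheorem5 {X : Type*} [MeasurableSpace X] [MeasurableSingletonClass X]
    (m : X → ℝ) (k : X → X → ℝ) (P : Measure (FunctionSpace X)) (hP : IsGP m k P) :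
    -- a single measurement at `x`
    (∀ x : X, k x x ≠ 0 →
      (∃! I : Kernel ℝ (FunctionSpace X),
        ∀ y : ℝ, IsGP (meanUpdate m k x y) (covUpdate k x) (I y)) ∧
      (∀ I : Kernel ℝ (FunctionSpace X),
        (∀ y : ℝ, IsGP (meanUpdate m k x y) (covUpdate k x) (I y)) →
          IsInferenceMap P (FunctionSpace.sampling x) I) ∧
      (Measurable m → Measurable (fun z => k z x) →
        ∀ y : ℝ, Measurable (meanUpdate m k x y))) ∧
    -- `N` successive measurements `(x i, y i)`, `i < N`, at independent points
    (∀ (N : ℕ) (x : ℕ → X) (y : ℕ → ℝ), (gram k x N).det ≠ 0 →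
      (∀ i < N, 0 < iterCov k x i (x i) (x i)) ∧
      iterMean m k x y N = batchMean m k x y N ∧
      iterCov k x N = batchCov k x N ∧
      (∃ (Q : ℕ → Measure (FunctionSpace X)) (I : ℕ → Kernel ℝ (FunctionSpace X)),
        Q 0 = P ∧
        (∀ i < N,
          (∀ v : ℝ, IsGP (meanUpdate (iterMean m k x y i) (iterCov k x i) (x i) v)
            (covUpdate (iterCov k x i) (x i)) (I i v)) ∧
          IsInferenceMap (Q i) (FunctionSpace.sampling (x i)) (I i) ∧
          Q (i + 1) = I i (y i)) ∧
        (∀ i ≤ N, IsGP (iterMean m k x y i) (iterCov k x i) (Q i)) ∧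
        IsGP (batchMean m k x y N) (batchCov k x N) (Q N)) ∧
      (Measurable m → (∀ j < N, Measurable (fun z => k z (x j))) →
        ∀ i ≤ N, Measurable (iterMean m k x y i))) := by
  have := hP.isProbabilityMeasure
  refine ⟨fun x hx => ⟨⟨posteriorKernel P k x, hP.isGP_posteriorKernel hx,
    fun I hI => hP.eq_posteriorKernel hx hI⟩, fun I hI => ?_,
    fun hm hk y => measurable_meanUpdate hm hk y⟩, fun N x y hdet => ?_⟩
  · rw [hP.eq_posteriorKernel hx hI]
    exact hP.isInferenceMap_posteriorKernel hx
  have hdets : ∀ i ≤ N, (gram k x i).det ≠ 0 := fun i hi =>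
    det_gram_ne_zero_of_le (hP.posSemidef_gram x N) hdet hi
  have hne : ∀ i < N, iterCov k x i (x i) (x i) ≠ 0 := fun i hi => by
    rw [iterCov_eq_batchCov fun j hj => hdets j (hj.trans hi.le)]
    exact batchCov_self_ne_zero k x (hdets i hi.le) (hdets (i + 1) hi)
  have hmean := iterMean_eq_batchMean m y hdets
  have hcov := iterCov_eq_batchCov hdets
  obtain ⟨Q, I, h0, hI, hQ⟩ := hP.exists_iterated_inference y hne
  refine ⟨fun i hi => ((hQ i hi.le).cov_self_nonneg (x i)).lt_of_ne' (hne i hi), hmean, hcov,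
    ⟨Q, I, h0, hI, hQ, ?_⟩, fun hm hk i hi => measurable_iterMean hm y hk hi⟩
  rw [← hmean, ← hcov]
  exact hQ N le_rfl
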